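/- **Theorem (Generic Degree).** Let $\mathbb K$ be an infinite field, and let $n>1$ and $d\ge 0$ be integers. For a polynomial vector or matrix, $\deg$ denotes the maximum of the degrees of its entries. For a nonzero row vector $\mathbf a\in\mathbb K[s]^n$, let $\gcd(\mathbf a)$ be the monic greatest common divisor of its entries. A *moving frame* at $\mathbf a$ is an invertible matrix $P\in GL_n(\mathbb K[s])$ with $\mathbf a P=[\gcd(\mathbf a),0,\dots,0]$. It is *degree-optimal* if its columns satisfy $\deg(P_{*2})\le\dots\le\deg(P_{*n})$ and if, for every moving frame $P'$ at $\mathbf a$ with $\deg(P'_{*2})\le\dots\le\deg(P'_{*n})$, we have $\deg(P_{*i})\le\deg(P'_{*i})$ for $i=1,\dots,n$. Then for generic $\mathbf a\in\mathbb K[s]^n$ with $\deg(\mathbf a)=d$ and $\gcd(\mathbf a)=1$, every degree-optimal moving frame $P$ at $\mathbf a$ satisfies $$\deg(P)=\left\lceil\frac{d}{n-1}\right\rceil .$$ Here "generic" means the following: identify the vectors in $\mathbb K[s]^n$ of degree at most $d$ with the points of the affine space $\mathbb K^{n(d+1)}$ of their coefficients, with its Zariski topology; then there is a nonempty, Zariski-open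 and Zariski-dense subset $U$ of this space such that every $\mathbf a\in U$ satisfies $\deg(\mathbf a)=d$ and $\gcd(\mathbf a)=1$, and every degree-optimal moving frame $P$ at every $\mathbf a\in U$ has $\deg(P)=\lceil d/(n-1)\rceil$. -/

import Mathlib

open Polynomial
open scoped Matrix

/-- The Zariski topology on the affine space `σ → K`: it is generated by (and in fact has as a
basis) the sets where a polynomial does not vanish. -/
abbrev zariskiTopology (σ K : Type*) [Field K] : TopologicalSpace (σ → K) :=
  TopologicalSpace.generateFrom
    (Set.range fun F : MvPolynomial σ K => {c : σ → K | MvPolynomial.eval c F ≠ 0})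

/-- The degree of a polynomial vector: the maximum of the degrees of its entries
(`⊥` for the zero vector). -/
noncomputable def vecDegree {K : Type*} [Field K] {n : ℕ} (h : Fin n → K[X]) : WithBot ℕ :=
  Finset.univ.sup fun i => (h i).degree

/-- The degree of a polynomial matrix: the maximum of the degrees of its entries. -/
noncomputable def matDegree {K : Type*} [Field K] {n : ℕ}
    (P : Matrix (Fin n) (Fin n) K[X]) : WithBot ℕ :=
  Finset.univ.sup fun i => Finset.univ.sup fun j => (P i j).degree

/-- `g` is the monic greatest common divisor of the entries of `a`. (It is unique if it exists,
and it exists exactly when `a` is nonzero.) -/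
def IsMonicGcd {K : Type*} [Field K] {n : ℕ} (a : Fin n → K[X]) (g : K[X]) : Prop :=
  g.Monic ∧ (∀ i, g ∣ a i) ∧ ∀ h : K[X], (∀ i, h ∣ a i) → h ∣ g

/-- `P` is an (algebraic) moving frame at the row vector `a`: an invertible matrix over `K[X]`
with `a P = [gcd a, 0, …, 0]`. -/
def IsMovingFrame {K : Type*} [Field K] {n : ℕ} (a : Fin n → K[X])
    (P : Matrix (Fin n) (Fin n) K[X]) : Prop :=
  IsUnit P ∧ ∃ g : K[X], IsMonicGcd a g ∧
    ∀ j : Fin n, (a ᵥ* P) j = if (j : ℕ) = 0 then g else 0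

/-- The columns of `P` other than the first one are ordered by degree. -/
def DegreeOrdered {K : Type*} [Field K] {n : ℕ} (P : Matrix (Fin n) (Fin n) K[X]) : Prop :=
  ∀ i j : Fin n, 0 < (i : ℕ) → i ≤ j → vecDegree (P.col i) ≤ vecDegree (P.col j)

/-- `P` is a degree-optimal moving frame at `a`. -/
def IsDegreeOptimalFrame {K : Type*} [Field K] {n : ℕ} (a : Fin n → K[X])
    (P : Matrix (Fin n) (Fin n) K[X]) : Prop :=
  IsMovingFrame a P ∧ DegreeOrdered P ∧
    ∀ P' : Matrix (Fin n) (Fin n) K[X], IsMovingFrame a P' → DegreeOrdered P' →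
      ∀ i : Fin n, vecDegree (P.col i) ≤ vecDegree (P'.col i)

/-- The polynomial vector of length `n` and degree at most `d` with coefficients `c`: the
coefficient of `X ^ i` in the `j`-th entry is `c (i, j)`. This identifies the affine space of
dimension `n (d + 1)` with the space of polynomial vectors of length `n` and degree at most `d`. -/
noncomputable def polyVec {K : Type*} [Field K] {n d : ℕ} (c : Fin (d + 1) × Fin n → K) :
    Fin n → K[X] :=
  fun j => ∑ i : Fin (d + 1), C (c (i, j)) * X ^ (i : ℕ)

/-! Put `N = n - 1` and `k = ⌈d / N⌉`, the least `m` with `d ≤ N * m`. Lower bound: if `a P = [1, 0,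
…, 0]`, Cramer's rule makes `det P • a` a vector of minors of the last `N` columns of `P`. Hence `d
≤ N * deg P`, so `k ≤ deg P` (`IsMovingFrame.le_matDegree`). Upper bound: optimality is columnwise,
so one ordered frame of degree at most `k` suffices (`IsBalanced.exists_movingFrame`). For generic
`a`, the map `v ↦ ∑ a i * v i` is onto degrees below `d + k` on vectors of degree below `k`, and
injective on vectors of degree below `k - 1`. Surjectivity yields a Bezout vector and syzygies of
degree `k` with any admissible leading vector; injectivity makes the leading vectors of the syzygies
of degree `k - 1` independent. Together they give `N` syzygies with independent leading vectors, and
rank-nullity bounds their total degree by `d`, which forces the determinant to be constant.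
Genericity: both conditions follow from nonvanishing determinants in the coefficients of `a`, shown
to be nonzero polynomials by evaluation at vectors of monomials (`exists_polynomial_isBalanced`). -/

/-! ### Zariski-open sets. -/

theorem exists_mvPolynomial_of_finite_inter {σ K : Type*} [Field K]
    {f : Set (Set (σ → K))} (hf : f.Finite)
    (hsub : f ⊆ Set.range fun F : MvPolynomial σ K => {c : σ → K | MvPolynomial.eval c F ≠ 0}) :
    ∃ G : MvPolynomial σ K, ⋂₀ f = {c : σ → K | MvPolynomial.eval c G ≠ 0} := by
  induction f, hf using Set.Finite.induction_on with
  | empty => exact ⟨1, by simp⟩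
  | @insert s t _ _ ih =>
    obtain ⟨G, hG⟩ := ih ((Set.subset_insert _ _).trans hsub)
    obtain ⟨F, rfl⟩ := hsub (Set.mem_insert _ _)
    refine ⟨F * G, ?_⟩
    rw [Set.sInter_insert, hG]
    ext c
    simp

/-- Over an infinite field the nonvanishing set of a nonzero polynomial is Zariski-dense. -/
theorem dense_zariski_eval_ne_zero {σ K : Type*} [Field K] [Infinite K]
    {F : MvPolynomial σ K} (hF : F ≠ 0) :
    @Dense _ (zariskiTopology σ K) {c : σ → K | MvPolynomial.eval c F ≠ 0} := by
  let _ := zariskiTopology σ K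
  have hb := TopologicalSpace.isTopologicalBasis_of_subbasis (t := zariskiTopology σ K) rfl
  refine hb.dense_iff.2 ?_
  rintro _ ⟨f, ⟨hfin, hsub⟩, rfl⟩ ⟨c₀, hc₀⟩
  obtain ⟨G, hG⟩ := exists_mvPolynomial_of_finite_inter hfin hsub
  have hG0 : G ≠ 0 := by
    rintro rfl
    simp [hG] at hc₀
  simp only [hG]
  by_contra hne
  -- Over an infinite field the nonzero product `G * F` cannot vanish everywhere.
  refine mul_ne_zero hG0 hF (MvPolynomial.funext fun c => ?_)
  by_contra h
  exact hne ⟨c, by simpa [not_or] using h⟩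

theorem isOpen_zariski_eval_ne_zero {σ K : Type*} [Field K] (F : MvPolynomial σ K) :
    @IsOpen _ (zariskiTopology σ K) {c : σ → K | MvPolynomial.eval c F ≠ 0} :=
  TopologicalSpace.isOpen_generateFrom_of_mem ⟨F, rfl⟩

/-! ### Degrees of determinants and leading coefficient vectors. -/

theorem natDegree_det_le_sum {R ι : Type*} [CommRing R] [Fintype ι] [DecidableEq ι]
    (M : Matrix ι ι R[X]) (e : ι → ℕ) (h : ∀ i j, (M i j).natDegree ≤ e j) :
    M.det.natDegree ≤ ∑ j, e j := by
  rw [Matrix.det_apply]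
  refine natDegree_sum_le_of_forall_le _ _ fun σ _ => ?_
  refine (natDegree_smul_le _ _).trans ((natDegree_prod_le _ _).trans ?_)
  exact Finset.sum_le_sum fun i _ => h _ _

/-- If `a P = e₀`, then `det P • a` is the vector of cofactors of the first column of `P`. -/
theorem det_mul_eq_det_updateCol {R ι : Type*} [CommRing R] [Fintype ι] [DecidableEq ι]
    {a : ι → R} {P : Matrix ι ι R} {z : ι} (h : a ᵥ* P = Pi.single z 1) (i : ι) :
    P.det * a i = (P.updateCol z (Pi.single i 1)).det := by
  have h1 : (a ᵥ* P) ᵥ* P.adjugate = P.det • a := by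
    rw [Matrix.vecMul_vecMul, Matrix.mul_adjugate, Matrix.vecMul_smul, Matrix.vecMul_one]
  have h2 := congrFun h1 i
  rw [h, Matrix.single_one_vecMul] at h2
  simp only [Pi.smul_apply, smul_eq_mul] at h2
  rw [← h2, Matrix.row_apply, ← Matrix.transpose_apply P.adjugate, Matrix.adjugate_transpose,
    Matrix.adjugate_apply, ← Matrix.det_transpose, Matrix.updateRow_transpose,
    Matrix.transpose_transpose]

/-- The replaced first column is constant and contributes degree `0`. This bound gives both the
lower bound on frame degrees and the unimodularity of the constructed frame. -/
theorem natDegree_det_mul_le {R : Type*} [CommRing R] {N : ℕ}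
    {a : Fin (N + 1) → R[X]} {P : Matrix (Fin (N + 1)) (Fin (N + 1)) R[X]}
    (h : a ᵥ* P = Pi.single 0 1) (e : Fin N → ℕ)
    (he : ∀ i j, (P i (Fin.succ j)).natDegree ≤ e j) (i : Fin (N + 1)) :
    (P.det * a i).natDegree ≤ ∑ j, e j := by
  rw [det_mul_eq_det_updateCol h]
  refine (natDegree_det_le_sum _ (Fin.cons 0 e) ?_).trans (by simp [Fin.sum_univ_succ])
  intro l j
  refine Fin.cases ?_ (fun j => ?_) j
  · simp only [Matrix.updateCol_self, Fin.cons_zero, Pi.single_apply]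
    split_ifs <;> simp
  · simpa [Matrix.updateCol_ne (Fin.succ_ne_zero j)] using he l j

/-- Polynomial vectors with linearly independent leading coefficient vectors are linearly
independent over the polynomial ring. -/
theorem eq_zero_of_sum_mul_eq_zero {K ι κ : Type*} [Field K] [Fintype ι]
    {u : ι → κ → K[X]} {e : ι → ℕ} (hdeg : ∀ j i, (u j i).natDegree ≤ e j)
    (hli : LinearIndependent K fun j i => (u j i).coeff (e j))
    {v : ι → K[X]} (hv : ∀ i, ∑ j, v j * u j i = 0) : v = 0 := by
  classical
  by_contra hne
  let s := Finset.univ.filter fun j => v j ≠ 0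
  have hs : s.Nonempty := by
    obtain ⟨j, hj⟩ := Function.ne_iff.1 hne
    exact ⟨j, by simpa [s] using hj⟩
  obtain ⟨j₀, hj₀, hmax⟩ := s.exists_max_image (fun j => (v j).natDegree + e j) hs
  -- `D` is the top degree available to any product `v j * u j i`; its coefficients form a linear
  -- relation `w` among the leading vectors, and `w j₀` is the leading coefficient of `v j₀`.
  set D := (v j₀).natDegree + e j₀ with hD
  let w : ι → K := fun j => if e j ≤ D then (v j).coeff (D - e j) else 0
  have hterm : ∀ i j, (v j * u j i).coeff D = w j * (u j i).coeff (e j) := by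
    intro i j
    by_cases hj : v j = 0
    · simp [w, hj]
    have hle : (v j).natDegree + e j ≤ D := hmax j (by simpa [s] using hj)
    have hle' : e j ≤ D := by omega
    simp only [w, if_pos hle']
    conv_lhs => rw [show D = (D - e j) + e j by omega]
    exact coeff_mul_add_eq_of_natDegree_le (by omega) (hdeg j i)
  have hw : ∑ j, w j • (fun i => (u j i).coeff (e j)) = 0 := by
    funext i
    have := congrArg (fun p => p.coeff D) (hv i)
    simpa [finsetSum_coeff, hterm] using this
  have := Fintype.linearIndependent_iff.1 hli w hw j₀
  rw [show w j₀ = (v j₀).coeff (v j₀).natDegree by simp [w, hD]] at this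
  exact (Finset.mem_filter.1 hj₀).2 (leadingCoeff_eq_zero.1 this)

/-! ### Shift matrices: generic solvability and injectivity. -/

/-- The matrix of the coefficients of index `row p` of the products `X ^ t q * a (j q)`. -/
noncomputable def shiftMatrix {K ι : Type*} [Field K] {n : ℕ} (a : Fin n → K[X])
    (j : ι → Fin n) (t row : ι → ℕ) : Matrix ι ι K :=
  Matrix.of fun p q => (X ^ t q * a (j q)).coeff (row p)

theorem coeff_polyVec {K : Type*} [Field K] {n d : ℕ} (c : Fin (d + 1) × Fin n → K) (j : Fin n)
    (l : ℕ) : (polyVec c j).coeff l = if h : l < d + 1 then c (⟨l, h⟩, j) else 0 := by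
  simp only [polyVec, finsetSum_coeff, coeff_C_mul_X_pow]
  split_ifs with h
  · rw [Finset.sum_eq_single ⟨l, h⟩] <;> simp +contextual [Fin.ext_iff, eq_comm]
  · refine Finset.sum_eq_zero fun i _ => if_neg ?_
    have := i.2
    omega

theorem natDegree_polyVec_le {K : Type*} [Field K] {n d : ℕ} (c : Fin (d + 1) × Fin n → K)
    (j : Fin n) : (polyVec c j).natDegree ≤ d := by
  refine natDegree_le_iff_coeff_eq_zero.2 fun l hl => ?_
  rw [coeff_polyVec, dif_neg (by omega)]

/-- The determinant of a shift matrix is a polynomial in the coefficients of the vector. -/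
theorem exists_eval_eq_det_shiftMatrix (K : Type*) {ι : Type*} [Field K] [Fintype ι] [DecidableEq ι]
    {n : ℕ} (d : ℕ) (j : ι → Fin n) (t row : ι → ℕ) :
    ∃ F : MvPolynomial (Fin (d + 1) × Fin n) K, ∀ c,
      MvPolynomial.eval c F = (shiftMatrix (polyVec c) j t row).det := by
  refine ⟨(Matrix.of fun p q => if t q ≤ row p then
    (if h : row p - t q < d + 1 then MvPolynomial.X (⟨row p - t q, h⟩, j q) else 0)
      else 0 : Matrix ι ι (MvPolynomial (Fin (d + 1) × Fin n) K)).det, fun c => ?_⟩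
  rw [RingHom.map_det]
  congr 1
  ext p q
  simp only [shiftMatrix, RingHom.mapMatrix_apply, Matrix.map_apply, Matrix.of_apply,
    coeff_X_pow_mul', coeff_polyVec]
  split_ifs <;> simp

theorem exists_polyVec_eq_X_pow (K : Type*) [Field K] {n d : ℕ} (e : Fin n → ℕ)
    (he : ∀ j, e j ≤ d) : ∃ c : Fin (d + 1) × Fin n → K, ∀ j, polyVec c j = X ^ e j := by
  refine ⟨fun x => if (x.1 : ℕ) = e x.2 then 1 else 0, fun j => ?_⟩
  ext l
  rw [coeff_polyVec, coeff_X_pow]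
  have := he j
  split_ifs <;> first | rfl | omega

/-- At the monomial vector `X ^ e j` the shift matrix is the identity, because `row` is injective.
-/
theorem shiftMatrix_det_polynomial_ne_zero {K ι : Type*} [Field K] [Fintype ι] [DecidableEq ι]
    {n d : ℕ} (j : ι → Fin n) (t row : ι → ℕ) (hrow : Function.Injective row)
    (e : Fin n → ℕ) (he : ∀ j, e j ≤ d) (hsum : ∀ p, row p = t p + e (j p))
    {F : MvPolynomial (Fin (d + 1) × Fin n) K}
    (hF : ∀ c, MvPolynomial.eval c F = (shiftMatrix (polyVec c) j t row).det) : F ≠ 0 := by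
  rintro rfl
  obtain ⟨c, hc⟩ := exists_polyVec_eq_X_pow K e he
  have h1 : shiftMatrix (polyVec c) j t row = 1 := by
    ext p q
    simp only [shiftMatrix, Matrix.of_apply, hc, ← pow_add, ← hsum, coeff_X_pow, hrow.eq_iff,
      Matrix.one_apply]
  simpa [h1] using hF c

/-- The rows select a square subsystem of the equations on the coefficients of `v`; its
nonsingularity already forces `v = 0`. -/
theorem sum_mul_eq_zero_imp {K : Type*} [Field K] {n k : ℕ} {a : Fin n → K[X]}
    {row : Fin n × Fin k → ℕ}
    (hdet : (shiftMatrix a Prod.fst (fun x : Fin n × Fin k => (x.2 : ℕ)) row).det ≠ 0)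
    {v : Fin n → K[X]} (hv : ∀ i, (v i).degree < k) (h : ∑ i, a i * v i = 0) : v = 0 := by
  have hexp : ∀ i, v i = ∑ t : Fin k, C ((v i).coeff t) * X ^ (t : ℕ) := fun i => by
    rw [Fin.sum_univ_eq_sum_range (fun t => C ((v i).coeff t) * X ^ t)]
    by_cases h0 : v i = 0
    · simp [h0]
    · exact (as_sum_range_C_mul_X_pow' _ ((natDegree_lt_iff_degree_lt h0).2 (hv i)))
  have hw := Matrix.eq_zero_of_mulVec_eq_zero hdet
    (v := fun x => (v x.1).coeff (x.2 : ℕ)) (by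
      ext p
      have := congrArg (fun q => q.coeff (row p)) h
      simp only [finsetSum_coeff, coeff_zero] at this
      rw [Pi.zero_apply, ← this]
      simp only [Matrix.mulVec, dotProduct, shiftMatrix, Matrix.of_apply, Fintype.sum_prod_type]
      refine Finset.sum_congr rfl fun i _ => ?_
      conv_rhs => rw [hexp i, Finset.mul_sum, finsetSum_coeff]
      refine Finset.sum_congr rfl fun t _ => ?_
      rw [mul_left_comm, coeff_C_mul, mul_comm (a i), mul_comm])
  funext i
  rw [hexp i, Pi.zero_apply]
  refine Finset.sum_eq_zero fun t _ => ?_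
  have := congrFun hw (i, t)
  simp only [Pi.zero_apply] at this
  simp [this]

/-- Here `d + k` of the shifts `X ^ t * a j` are selected; they form a basis of the polynomials of
degree below `d + k`. -/
theorem exists_sum_mul_eq {K : Type*} [Field K] {n k d : ℕ} {a : Fin n → K[X]}
    (ha : ∀ i, (a i).natDegree ≤ d) {j : Fin (d + k) → Fin n} {t : Fin (d + k) → ℕ}
    (ht : ∀ m, t m < k) (hdet : (shiftMatrix a j t (fun m => (m : ℕ))).det ≠ 0)
    {p : K[X]} (hp : p.degree < (d + k : ℕ)) :
    ∃ v : Fin n → K[X], (∀ i, (v i).degree < k) ∧ ∑ i, a i * v i = p := by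
  set M := shiftMatrix a j t (fun m : Fin (d + k) => (m : ℕ)) with hM
  let w := M⁻¹ *ᵥ fun m : Fin (d + k) => p.coeff m
  have hw : M *ᵥ w = fun m : Fin (d + k) => p.coeff m := by
    rw [Matrix.mulVec_mulVec, Matrix.mul_nonsing_inv _ (isUnit_iff_ne_zero.2 hdet),
      Matrix.one_mulVec]
  let v : Fin n → K[X] := fun i => ∑ m, if j m = i then C (w m) * X ^ t m else 0
  have hv : ∀ i, (v i).degree < k := fun i => by
    refine (degree_sum_le _ _).trans_lt ((Finset.sup_lt_iff (WithBot.bot_lt_coe k)).2 fun m _ => ?_)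
    split_ifs
    · exact (degree_C_mul_X_pow_le _ _).trans_lt (WithBot.coe_lt_coe.2 (ht m))
    · simp
  refine ⟨v, hv, ?_⟩
  have hs : ∑ i, a i * v i = ∑ m, C (w m) * (X ^ t m * a (j m)) := by
    simp only [v, Finset.mul_sum]
    rw [Finset.sum_comm]
    refine Finset.sum_congr rfl fun m _ => ?_
    simp only [mul_ite, mul_zero, Finset.sum_ite_eq, Finset.mem_univ, if_true]
    ring
  ext l
  by_cases hl : l < d + k
  · have := congrFun hw ⟨l, hl⟩
    simp only [Matrix.mulVec, dotProduct, hM, shiftMatrix, Matrix.of_apply] at this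
    rw [hs, finsetSum_coeff, ← this]
    exact Finset.sum_congr rfl fun m _ => by rw [coeff_C_mul, mul_comm]
  · rw [coeff_eq_zero_of_degree_lt (hp.trans_le (by exact_mod_cast not_lt.1 hl)), finsetSum_coeff]
    refine Finset.sum_eq_zero fun i _ => coeff_eq_zero_of_degree_lt ?_
    by_cases h0 : v i = 0
    · simp [h0]
    have h1 := (natDegree_lt_iff_degree_lt h0).2 (hv i)
    refine (degree_le_natDegree.trans_lt (Nat.cast_lt.2 ?_))
    have := natDegree_mul_le (p := a i) (q := v i)
    have := ha i
    omega

/-! ### Syzygies of balanced vectors. -/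

theorem degree_lt_of_natDegree_le_of_coeff_eq_zero {R : Type*} [Semiring R] {p : R[X]} {m : ℕ}
    (h : p.natDegree ≤ m) (h0 : p.coeff m = 0) : p.degree < m := by
  rw [degree_lt_iff_coeff_zero]
  intro l hl
  rcases hl.eq_or_lt with rfl | hl
  · exact h0
  · exact coeff_eq_zero_of_natDegree_lt (h.trans_lt hl)

theorem natDegree_le_pred_of_degree_lt {R : Type*} [Semiring R] {p : R[X]} {k : ℕ}
    (h : p.degree < k) : p.natDegree ≤ k - 1 := by
  by_cases h0 : p = 0
  · simp [h0]
  · have := (natDegree_lt_iff_degree_lt h0).2 h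
    omega

/-- The syzygies of `a` of degree less than `k`. -/
noncomputable def syzygyLT {K : Type*} [Field K] {n : ℕ} (a : Fin n → K[X]) (k : ℕ) :
    Submodule K (Fin n → degreeLT K k) :=
  LinearMap.ker (∑ i, (LinearMap.mulLeft K (a i)) ∘ₗ (degreeLT K k).subtype ∘ₗ LinearMap.proj i)

theorem mem_syzygyLT {K : Type*} [Field K] {n : ℕ} {a : Fin n → K[X]} {k : ℕ}
    {v : Fin n → degreeLT K k} : v ∈ syzygyLT a k ↔ ∑ i, a i * (v i : K[X]) = 0 := by
  simp [syzygyLT, LinearMap.sum_apply]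

theorem finrank_degreeLT (K : Type*) [Field K] (k : ℕ) : Module.finrank K (degreeLT K k) = k := by
  rw [(degreeLTEquiv K k).finrank_eq, Module.finrank_fin_fun]

instance finiteDimensional_degreeLT (K : Type*) [Field K] (k : ℕ) :
    FiniteDimensional K (degreeLT K k) :=
  Module.Finite.equiv (degreeLTEquiv K k).symm

/-- Rank-nullity: the products lie in the space of polynomials of degree below `d + k`. -/
theorem le_finrank_syzygyLT {K : Type*} [Field K] {n d : ℕ} {a : Fin n → K[X]}
    (ha : ∀ i, (a i).natDegree ≤ d) (k : ℕ) :
    n * k ≤ d + k + Module.finrank K (syzygyLT a k) := by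
  set f : (Fin n → degreeLT K k) →ₗ[K] K[X] :=
    ∑ i, (LinearMap.mulLeft K (a i)) ∘ₗ (degreeLT K k).subtype ∘ₗ LinearMap.proj i with hf
  have h1 := LinearMap.finrank_range_add_finrank_ker f
  have h2 : Module.finrank K (LinearMap.range f) ≤ d + k := by
    rw [← finrank_degreeLT K (d + k)]
    refine Submodule.finrank_mono ?_
    rintro _ ⟨v, rfl⟩
    rw [hf, LinearMap.sum_apply]
    refine Submodule.sum_mem _ fun i _ => ?_
    have hv := mem_degreeLT.1 (v i).2
    rw [mem_degreeLT]
    simp only [LinearMap.comp_apply, LinearMap.proj_apply, Submodule.subtype_apply,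
      LinearMap.mulLeft_apply]
    by_cases h0 : ((v i : K[X])) = 0
    · simp [h0]
    refine degree_le_natDegree.trans_lt (Nat.cast_lt.2 ?_)
    have h3 := (natDegree_lt_iff_degree_lt h0).2 hv
    have h4 := natDegree_mul_le (p := a i) (q := (v i : K[X]))
    have := ha i
    omega
  have h3 : Module.finrank K (Fin n → degreeLT K k) = n * k := by
    simp [Module.finrank_pi_fintype, finrank_degreeLT]
  change _ + Module.finrank K (syzygyLT a k) = _ at h1
  omega

/-- A vector whose products with polynomial vectors of degree less than `k` fill all degrees less
than `d + k`, and which has no nonzero syzygies of degree less than `k - 1`. -/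
structure IsBalanced {K : Type*} [Field K] {N : ℕ} (a : Fin (N + 1) → K[X]) (d k : ℕ) : Prop where
  natDegree_le : ∀ i, (a i).natDegree ≤ d
  coeff_ne_zero : (a 0).coeff d ≠ 0
  surj : ∀ p : K[X], p.degree < (d + k : ℕ) →
    ∃ v : Fin (N + 1) → K[X], (∀ i, (v i).degree < k) ∧ ∑ i, a i * v i = p
  inj : ∀ v : Fin (N + 1) → K[X], (∀ i, (v i).degree < (k - 1 : ℕ)) → ∑ i, a i * v i = 0 → v = 0

/-- The image of a basis under an injective linear map extends to a basis of the codomain. -/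
theorem exists_linearIndependent_sumElim {K V H : Type*} [Field K] [AddCommGroup V] [Module K V]
    [AddCommGroup H] [Module K H] [FiniteDimensional K V] [FiniteDimensional K H] {φ : V →ₗ[K] H}
    (hφ : Function.Injective φ) : ∃ (s : ℕ) (v : Fin (Module.finrank K V) → V) (y : Fin s → H),
      Module.finrank K V + s = Module.finrank K H ∧
      LinearIndependent K (Sum.elim (fun j => φ (v j)) y) := by
  let W := LinearMap.range φ
  let bV := Module.finBasis K V
  let bQ := Module.finBasis K (H ⧸ W)
  choose y hy using fun j => W.mkQ_surjective (bQ j)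
  refine ⟨_, bV, y, ?_, ?_⟩
  · rw [← LinearMap.finrank_range_of_inj hφ, add_comm]
    exact W.finrank_quotient_add_finrank
  · have h1 : LinearIndependent K (φ.rangeRestrict ∘ bV) :=
      bV.linearIndependent.map' _ (by rw [LinearMap.ker_rangeRestrict, LinearMap.ker_eq_bot.2 hφ])
    refine h1.sumElim_of_quotient y ?_
    rw [show Submodule.Quotient.mk ∘ y = bQ from funext hy]
    exact bQ.linearIndependent

section

variable {K : Type*} [Field K] {N d k : ℕ} {a : Fin (N + 1) → K[X]}

/-- The linear form given by the coefficients of index `d` of the vector `a`. -/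
noncomputable def leadForm (a : Fin (N + 1) → K[X]) (d : ℕ) : Module.Dual K (Fin (N + 1) → K) :=
  ∑ i, (a i).coeff d • LinearMap.proj i

theorem leadForm_apply (x : Fin (N + 1) → K) : leadForm a d x = ∑ i, (a i).coeff d * x i := by
  simp [leadForm, LinearMap.sum_apply]

theorem leadForm_coeff (ha : ∀ i, (a i).natDegree ≤ d) {v : Fin (N + 1) → K[X]} {m : ℕ}
    (hv : ∀ i, (v i).natDegree ≤ m) :
    leadForm a d (fun i => (v i).coeff m) = (∑ i, a i * v i).coeff (d + m) := by
  rw [leadForm_apply, finsetSum_coeff]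
  exact Finset.sum_congr rfl fun i _ => (coeff_mul_add_eq_of_natDegree_le (ha i) (hv i)).symm

theorem finrank_ker_leadForm (h : (a 0).coeff d ≠ 0) :
    Module.finrank K (LinearMap.ker (leadForm a d)) = N := by
  have h0 : leadForm a d ≠ 0 := by
    intro h0
    have := LinearMap.congr_fun h0 (Pi.single 0 1)
    rw [leadForm_apply] at this
    simp [Pi.single_apply, h] at this
  have := Module.Dual.finrank_ker_add_one_of_ne_zero h0
  simpa using this

/-- The coefficient vector of index `k - 1` of a syzygy of degree less than `k`. -/
noncomputable def syzygyLead (ha : ∀ i, (a i).natDegree ≤ d) (k : ℕ) :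
    syzygyLT a k →ₗ[K] LinearMap.ker (leadForm a d) :=
  LinearMap.codRestrict _
    ((LinearMap.pi fun i => lcoeff K (k - 1) ∘ₗ (degreeLT K k).subtype ∘ₗ LinearMap.proj i) ∘ₗ
      (syzygyLT a k).subtype) fun v => by
    rw [LinearMap.mem_ker]
    refine (leadForm_coeff ha (v := fun i => (v.1 i : K[X])) fun i =>
      natDegree_le_pred_of_degree_lt (mem_degreeLT.1 (v.1 i).2)).trans ?_
    rw [mem_syzygyLT.1 v.2, coeff_zero]

theorem syzygyLead_apply (ha : ∀ i, (a i).natDegree ≤ d) (v : syzygyLT a k) (i : Fin (N + 1)) :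
    (syzygyLead ha k v).1 i = (v.1 i : K[X]).coeff (k - 1) := rfl

/-- If the coefficients of index `k - 1` vanish, the degree drops below `k - 1`, where `inj` leaves
only zero. -/
theorem IsBalanced.syzygyLead_injective (h : IsBalanced a d k) :
    Function.Injective (syzygyLead h.natDegree_le k) := by
  refine (injective_iff_map_eq_zero _).2 fun v hv => ?_
  have := h.inj (fun i => v.1 i) (fun i => degree_lt_of_natDegree_le_of_coeff_eq_zero
    (natDegree_le_pred_of_degree_lt (mem_degreeLT.1 (v.1 i).2)) (by
      rw [← syzygyLead_apply h.natDegree_le, hv]; rfl)) (mem_syzygyLT.1 v.2)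
  ext i : 3
  exact congrFun this i

/-- Every vector in the kernel of the leading form is the leading coefficient vector of a syzygy of
degree `k`. -/
theorem IsBalanced.exists_syzygy (h : IsBalanced a d k) {x : Fin (N + 1) → K}
    (hx : leadForm a d x = 0) : ∃ u : Fin (N + 1) → K[X], (∀ i, (u i).natDegree ≤ k) ∧
      (∀ i, (u i).coeff k = x i) ∧ ∑ i, a i * u i = 0 := by
  have hd : ∀ i, (C (x i) * X ^ k).natDegree ≤ k := fun i => natDegree_C_mul_X_pow_le _ _
  -- The coefficient of index `d + k` is `leadForm a d x = 0`, so this combination can be cancelled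
  -- by a `v` of degree below `k`.
  obtain ⟨v, hv, hav⟩ := h.surj (∑ i, a i * (C (x i) * X ^ k)) (by
    refine degree_lt_of_natDegree_le_of_coeff_eq_zero ?_ ?_
    · refine natDegree_sum_le_of_forall_le _ _ fun i _ => natDegree_mul_le.trans ?_
      exact add_le_add (h.natDegree_le i) (hd i)
    · rw [← leadForm_coeff h.natDegree_le hd]
      simpa using hx)
  refine ⟨fun i => C (x i) * X ^ k - v i, fun i => ?_, fun i => ?_, ?_⟩
  · refine (natDegree_sub_le _ _).trans (max_le (hd i) ?_)
    exact (natDegree_le_pred_of_degree_lt (hv i)).trans (Nat.sub_le _ _)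
  · simp [coeff_eq_zero_of_degree_lt (hv i)]
  · simp [mul_sub, Finset.sum_sub_distrib, hav]

theorem IsBalanced.exists_bezout (h : IsBalanced a d k) (hdk : d ≤ N * k) :
    ∃ b : Fin (N + 1) → K[X], (∀ i, (b i).natDegree ≤ k) ∧ ∑ i, a i * b i = 1 := by
  rcases Nat.eq_zero_or_pos k with rfl | hk
  -- For `k = 0` surjectivity says nothing about `1` when `d = 0`, but `a 0` is then a nonzero
  -- constant.
  · obtain rfl : d = 0 := by simpa using hdk
    have ha : a 0 = C ((a 0).coeff 0) := eq_C_of_natDegree_le_zero (h.natDegree_le 0)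
    refine ⟨Pi.single 0 (C ((a 0).coeff 0)⁻¹), fun i => ?_, ?_⟩
    · rw [Pi.single_apply]
      split_ifs <;> simp
    · simp only [Pi.single_apply, mul_ite, mul_zero, Finset.sum_ite_eq', Finset.mem_univ, if_true]
      conv_lhs => rw [ha]
      rw [coeff_C_zero, ← C_mul, mul_inv_cancel₀ h.coeff_ne_zero, C_1]
  · obtain ⟨v, hv, hav⟩ := h.surj 1 (by
      rw [degree_one]
      exact_mod_cast (by omega : 0 < d + k))
    exact ⟨v, fun i => (natDegree_le_pred_of_degree_lt (hv i)).trans (Nat.sub_le _ _), hav⟩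

/-- A balanced vector has `N` syzygies with linearly independent leading coefficient vectors, of
nondecreasing degrees at most `k` with sum at most `d`. -/
theorem IsBalanced.exists_syzygies (h : IsBalanced a d k) (hdk : d ≤ N * k) :
    ∃ (u : Fin N → Fin (N + 1) → K[X]) (e : Fin N → ℕ), Monotone e ∧ (∀ j, e j ≤ k) ∧
      ∑ j, e j ≤ d ∧ (∀ j i, (u j i).natDegree ≤ e j) ∧
      (LinearIndependent K fun j i => (u j i).coeff (e j)) ∧ ∀ j, ∑ i, a i * u j i = 0 := by
  obtain ⟨s, v, y, hsum, hli⟩ :=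
    exists_linearIndependent_sumElim (K := K) (V := syzygyLT a k)
      (H := LinearMap.ker (leadForm a d)) h.syzygyLead_injective
  rw [finrank_ker_leadForm h.coeff_ne_zero] at hsum
  have hrk := le_finrank_syzygyLT h.natDegree_le k
  generalize Module.finrank K (syzygyLT a k) = r at *
  choose u hu hu' hau using fun j => h.exists_syzygy (LinearMap.mem_ker.1 (y j).2)
  let E : Fin r ⊕ Fin s → ℕ := Sum.elim (fun _ => k - 1) (fun _ => k)
  let V : Fin r ⊕ Fin s → Fin (N + 1) → K[X] := Sum.elim (fun j i => ((v j).1 i : K[X])) u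
  have hEk : ∀ x, E x ≤ k := by rintro (x | x) <;> simp [E]
  -- For `k > 0` the sum is `r * (k - 1) + s * k = N * k - r`, and `hrk` says `N * k ≤ d + r`. For
  -- `k = 0` truncated subtraction makes it `0`.
  have hE : ∑ x, E x ≤ d := by
    simp only [Fintype.sum_sum_type, E, Sum.elim_inl, Sum.elim_inr, Finset.sum_const,
      Finset.card_univ, Fintype.card_fin, smul_eq_mul]
    rcases k with _ | k
    · simp
    · simp only [Nat.add_sub_cancel]
      rw [← hsum] at hrk
      linarith
  have hVE : ∀ x i, (V x i).natDegree ≤ E x := by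
    rintro (x | x) i
    · exact natDegree_le_pred_of_degree_lt (mem_degreeLT.1 ((v x).1 i).2)
    · exact hu x i
  have hV : ∀ x, ∑ i, a i * V x i = 0 := by
    rintro (x | x)
    · exact mem_syzygyLT.1 (v x).2
    · exact hau x
  have hVli : LinearIndependent K fun x i => (V x i).coeff (E x) := by
    have h1 := hli.map' (LinearMap.ker (leadForm a d)).subtype (Submodule.ker_subtype _)
    have h2 : (fun x i => (V x i).coeff (E x)) = (LinearMap.ker (leadForm a d)).subtype ∘
        Sum.elim (fun j => syzygyLead h.natDegree_le k (v j)) y := by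
      funext x
      rcases x with x | x
      · rfl
      · exact funext (hu' x)
    rw [h2]
    exact h1
  clear_value E V
  let σ₀ : Fin N ≃ Fin r ⊕ Fin s := (finCongr hsum.symm).trans finSumFinEquiv.symm
  let σ : Fin N ≃ Fin r ⊕ Fin s := (Tuple.sort (E ∘ σ₀)).trans σ₀
  exact ⟨fun j => V (σ j), fun j => E (σ j), Tuple.monotone_sort (E ∘ σ₀), fun j => hEk _,
    (σ.sum_comp E).trans_le hE, fun j => hVE _, hVli.comp σ σ.injective, fun j => hV _⟩

end

/-! ### Degree bounds for moving frames. -/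

theorem vecDegree_le_iff {K : Type*} [Field K] {n : ℕ} {v : Fin n → K[X]} {b : WithBot ℕ} :
    vecDegree v ≤ b ↔ ∀ i, (v i).degree ≤ b := by
  simp [vecDegree]

theorem degree_le_matDegree {K : Type*} [Field K] {n : ℕ} (P : Matrix (Fin n) (Fin n) K[X])
    (i j : Fin n) : (P i j).degree ≤ matDegree P :=
  (Finset.le_sup (f := fun j => (P i j).degree) (Finset.mem_univ j)).trans
    (Finset.le_sup (f := fun i => Finset.univ.sup fun j => (P i j).degree) (Finset.mem_univ i))

theorem matDegree_le_iff {K : Type*} [Field K] {n : ℕ} {P : Matrix (Fin n) (Fin n) K[X]}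
    {b : WithBot ℕ} : matDegree P ≤ b ↔ ∀ j, vecDegree (P.col j) ≤ b := by
  simp only [matDegree, vecDegree, Finset.sup_le_iff, Finset.mem_univ, true_imp_iff, Matrix.col_apply]
  exact forall_comm

theorem isMonicGcd_one_of_sum_mul_eq_one {K : Type*} [Field K] {n : ℕ} {a b : Fin n → K[X]}
    (h : ∑ i, a i * b i = 1) : IsMonicGcd a 1 :=
  ⟨monic_one, fun _ => one_dvd _, fun _ hg =>
    h ▸ Finset.dvd_sum fun i _ => dvd_mul_of_dvd_left (hg i) _⟩

theorem IsMonicGcd.eq {K : Type*} [Field K] {n : ℕ} {a : Fin n → K[X]} {g g' : K[X]}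
    (h : IsMonicGcd a g) (h' : IsMonicGcd a g') : g = g' :=
  eq_of_monic_of_associated h.1 h'.1
    (associated_of_dvd_dvd (h'.2.2 _ h.2.1) (h.2.2 _ h'.2.1))

section

variable {K : Type*} [Field K] {N d k : ℕ} {a : Fin (N + 1) → K[X]}

theorem IsMovingFrame.vecMul_eq {P : Matrix (Fin (N + 1)) (Fin (N + 1)) K[X]}
    (hP : IsMovingFrame a P) (ha : IsMonicGcd a 1) : a ᵥ* P = Pi.single 0 1 := by
  obtain ⟨-, g, hg, h⟩ := hP
  obtain rfl := hg.eq ha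
  funext j
  rw [h, Pi.single_apply]
  simp only [Fin.ext_iff, Fin.val_zero]

/-- The degree of a moving frame is at least the average degree of a basis of syzygies. -/
theorem IsMovingFrame.le_matDegree {P : Matrix (Fin (N + 1)) (Fin (N + 1)) K[X]}
    (hP : IsMovingFrame a P) (ha : IsMonicGcd a 1) (had : (a 0).coeff d ≠ 0)
    (hk : ∀ m, d ≤ N * m → k ≤ m) : (k : WithBot ℕ) ≤ matDegree P := by
  have hu : P.det ≠ 0 := ((Matrix.isUnit_iff_isUnit_det _).1 hP.1).ne_zero
  have hmul := hP.vecMul_eq ha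
  rcases hm : matDegree P with _ | m
  · have h0 : P = 0 := by
      ext1 i j
      exact degree_eq_bot.1 (le_bot_iff.1 ((degree_le_matDegree P i j).trans_eq hm))
    rw [h0, Matrix.vecMul_zero] at hmul
    simpa using congrFun hmul 0
  · refine Nat.cast_le.2 (hk m ?_)
    have h1 := natDegree_det_mul_le hmul (fun _ => m)
      (fun i j => natDegree_le_of_degree_le ((degree_le_matDegree P i _).trans_eq hm)) 0
    have ha0 : a 0 ≠ 0 := fun h => had (by simp [h])
    rw [natDegree_mul hu ha0] at h1
    have h2 := le_natDegree_of_ne_zero had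
    simp only [Finset.sum_const, Finset.card_univ, Fintype.card_fin, smul_eq_mul] at h1
    omega

/-- A balanced vector has a moving frame of degree at most `k`. -/
theorem IsBalanced.exists_movingFrame (h : IsBalanced a d k) (hdk : d ≤ N * k) :
    ∃ P : Matrix (Fin (N + 1)) (Fin (N + 1)) K[X], IsMovingFrame a P ∧ DegreeOrdered P ∧
      ∀ j, vecDegree (P.col j) ≤ k := by
  obtain ⟨b, hb, hab⟩ := h.exists_bezout hdk
  obtain ⟨u, e, hmono, hek, hsum, hdeg, hli, hau⟩ := h.exists_syzygies hdk
  let P : Matrix (Fin (N + 1)) (Fin (N + 1)) K[X] :=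
    Matrix.of fun i j => (Fin.cons b u : Fin (N + 1) → Fin (N + 1) → K[X]) j i
  have hP0 : ∀ i, P i 0 = b i := fun i => rfl
  have hPs : ∀ i j, P i (Fin.succ j) = u j i := fun i j => rfl
  have hmul : a ᵥ* P = Pi.single 0 1 := by
    funext j
    refine Fin.cases ?_ (fun j => ?_) j
    · simpa [Matrix.vecMul, dotProduct, hP0] using hab
    · simpa [Matrix.vecMul, dotProduct, hPs] using hau j
  have hdet : P.det ≠ 0 := by
    intro h0
    obtain ⟨v, hv, hPv⟩ := Matrix.exists_mulVec_eq_zero_iff.2 h0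
    -- Pairing `P v = 0` with `a` leaves `(a P) v = v 0`; the rest of `v` is a relation among the
    -- syzygies.
    have hv0 : v 0 = 0 := by
      have := Matrix.dotProduct_mulVec a P v
      rw [hPv, hmul] at this
      simpa using this.symm
    refine hv ?_
    have hvs : (fun j : Fin N => v j.succ) = 0 :=
      eq_zero_of_sum_mul_eq_zero hdeg hli fun i => by
        have := congrFun hPv i
        simp only [Matrix.mulVec, dotProduct, Fin.sum_univ_succ, hv0, hPs, mul_zero, zero_add,
          Pi.zero_apply] at this
        simpa [mul_comm] using this
    funext j
    exact Fin.cases hv0 (fun j => congrFun hvs j) j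
  have hunit : IsUnit P := by
    rw [Matrix.isUnit_iff_isUnit_det, isUnit_iff_degree_eq_zero, degree_eq_natDegree hdet]
    -- `det P * a 0` has degree at most `∑ e j ≤ d`, while `a 0` alone has degree at least `d`.
    have h1 := natDegree_det_mul_le hmul e (fun i j => hdeg j i) 0
    have ha0 : a 0 ≠ 0 := fun h' => h.coeff_ne_zero (by simp [h'])
    rw [natDegree_mul hdet ha0] at h1
    have h2 := le_natDegree_of_ne_zero h.coeff_ne_zero
    exact_mod_cast (by omega : P.det.natDegree = 0)
  have hcol : ∀ j, vecDegree (P.col j.succ) = e j := fun j => by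
    refine le_antisymm (vecDegree_le_iff.2 fun i => natDegree_le_iff_degree_le.1 (hdeg j i)) ?_
    obtain ⟨i, hi⟩ := Function.ne_iff.1 (hli.ne_zero j)
    exact (le_degree_of_ne_zero hi).trans (vecDegree_le_iff.1 le_rfl i)
  refine ⟨P, ⟨hunit, 1, isMonicGcd_one_of_sum_mul_eq_one hab, fun j => ?_⟩, fun i j hi hij => ?_,
    fun j => ?_⟩
  · rw [hmul, Pi.single_apply]
    simp only [Fin.ext_iff, Fin.val_zero]
  · obtain ⟨i, rfl⟩ := Fin.exists_succ_eq.2 (Fin.pos_iff_ne_zero.1 hi)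
    obtain ⟨j, rfl⟩ := Fin.exists_succ_eq.2 (Fin.pos_iff_ne_zero.1 ((Fin.succ_pos i).trans_le hij))
    rw [hcol, hcol]
    exact Nat.cast_le.2 (hmono (Fin.succ_le_succ_iff.1 hij))
  · refine Fin.cases ?_ (fun j => ?_) j
    · exact vecDegree_le_iff.2 fun i => natDegree_le_iff_degree_le.1 (hb i)
    · rw [hcol]
      exact Nat.cast_le.2 (hek j)

end

/-! ### Genericity and conclusion. -/

/-- Generic polynomial vectors are balanced. -/
theorem exists_polynomial_isBalanced (K : Type*) [Field K] {N d k : ℕ} (hdk : d ≤ N * k)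
    (hkd : N * (k - 1) ≤ d) : ∃ F : MvPolynomial (Fin (d + 1) × Fin (N + 1)) K, F ≠ 0 ∧
      ∀ c, MvPolynomial.eval c F ≠ 0 → IsBalanced (polyVec c) d k := by
  -- The windows of length `k` starting at `min (j * k) d` cover all exponents below `d + k`; since
  -- `d ≤ N * k`, the last one starts at `d`.
  have hj : ∀ m : Fin (d + k), ∃ j : Fin (N + 1),
      min (j * k) d ≤ m ∧ (m : ℕ) < min (j * k) d + k := by
    intro m
    have hm := m.2
    rcases lt_or_ge (m : ℕ) d with h | h
    · have hk : 0 < k := Nat.pos_of_ne_zero (by rintro rfl; omega)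
      have h1 : (m : ℕ) / k < N := (Nat.div_lt_iff_lt_mul hk).2 (h.trans_le hdk)
      refine ⟨⟨(m : ℕ) / k, by omega⟩, ?_⟩
      have h2 := Nat.div_add_mod' (m : ℕ) k
      have h3 := Nat.mod_lt (m : ℕ) hk
      simp only
      omega
    · refine ⟨Fin.last N, ?_⟩
      simp only [Fin.val_last]
      omega
  choose j hj1 hj2 using hj
  obtain ⟨F₁, hF₁⟩ := exists_eval_eq_det_shiftMatrix K d j (fun m => m - min (j m * k) d)
    (fun m : Fin (d + k) => (m : ℕ))
  have hF₁0 : F₁ ≠ 0 := shiftMatrix_det_polynomial_ne_zero j _ _ Fin.val_injective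
    (fun i => min (i * k) d) (fun i => min_le_right _ _)
    (fun m => (Nat.sub_add_cancel (hj1 m)).symm) hF₁
  -- For injectivity, disjoint windows of length `k - 1` are laid end to end; the last starts at `N
  -- * (k - 1) ≤ d`.
  obtain ⟨F₂, hF₂⟩ := exists_eval_eq_det_shiftMatrix K d (Prod.fst : Fin (N + 1) × Fin (k - 1) → _)
    (fun x => (x.2 : ℕ)) (fun x => (finProdFinEquiv x : ℕ))
  have hF₂0 : F₂ ≠ 0 := shiftMatrix_det_polynomial_ne_zero
    (Prod.fst : Fin (N + 1) × Fin (k - 1) → _) (fun x => (x.2 : ℕ))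
    (fun x => (finProdFinEquiv x : ℕ)) (Fin.val_injective.comp finProdFinEquiv.injective)
    (fun i => (k - 1) * i)
    (fun i => by
      rw [mul_comm]
      exact (Nat.mul_le_mul_right _ (Nat.lt_succ_iff.1 i.2)).trans hkd)
    (fun x => finProdFinEquiv_apply_val x) hF₂
  refine ⟨F₁ * F₂ * MvPolynomial.X (Fin.last d, 0), mul_ne_zero (mul_ne_zero hF₁0 hF₂0)
    (MvPolynomial.X_ne_zero _), fun c hc => ?_⟩
  simp only [map_mul, MvPolynomial.eval_X, mul_ne_zero_iff, hF₁, hF₂] at hc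
  obtain ⟨⟨h1, h2⟩, h3⟩ := hc
  refine ⟨natDegree_polyVec_le c, ?_, fun p hp => ?_, fun v hv => sum_mul_eq_zero_imp h2 hv⟩
  · rw [coeff_polyVec, dif_pos (Nat.lt_succ_self d)]
    exact h3
  · refine exists_sum_mul_eq (natDegree_polyVec_le c) (fun m => ?_) h1 hp
    have := hj1 m
    have := hj2 m
    omega

/-- For generic polynomial vectors of degree `d` with gcd `1`, that is, on a Zariski-open dense
subset of the coefficient space, consisting of such vectors, every degree-optimal moving frame has
degree `⌈d / (n - 1)⌉`. -/
theorem mainTheorem6 (K : Type*) [Field K] [Infinite K] (n d : ℕ) (hn : 1 < n) :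
    ∃ U : Set (Fin (d + 1) × Fin n → K),
      @IsOpen _ (zariskiTopology (Fin (d + 1) × Fin n) K) U ∧
      @Dense _ (zariskiTopology (Fin (d + 1) × Fin n) K) U ∧
      U.Nonempty ∧
      ∀ c ∈ U,
        vecDegree (polyVec c) = (d : WithBot ℕ) ∧
        IsMonicGcd (polyVec c) 1 ∧
        ∀ P : Matrix (Fin n) (Fin n) K[X], IsDegreeOptimalFrame (polyVec c) P →
          matDegree P = ((⌈(d : ℚ) / ((n : ℚ) - 1)⌉₊ : ℕ) : WithBot ℕ) := by
  obtain ⟨N, rfl⟩ : ∃ N, n = N + 1 := ⟨n - 1, by omega⟩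
  have hN : 0 < N := by omega
  -- This equivalence is all that is used about the ceiling.
  have hiff : ∀ m, ⌈(d : ℚ) / (((N + 1 : ℕ) : ℚ) - 1)⌉₊ ≤ m ↔ d ≤ N * m := fun m => by
    rw [Nat.ceil_le, Nat.cast_succ, add_sub_cancel_right, div_le_iff₀' (Nat.cast_pos.2 hN)]
    exact_mod_cast Iff.rfl
  generalize ⌈(d : ℚ) / (((N + 1 : ℕ) : ℚ) - 1)⌉₊ = k at hiff ⊢
  have hdk : d ≤ N * k := (hiff k).1 le_rfl
  have hkd : N * (k - 1) ≤ d := by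
    rcases Nat.eq_zero_or_pos k with rfl | hk
    · simp
    · exact (not_le.1 fun h => absurd ((hiff (k - 1)).2 h) (by omega)).le
  obtain ⟨F, hF0, hF⟩ := exists_polynomial_isBalanced K hdk hkd
  refine ⟨_, isOpen_zariski_eval_ne_zero F, dense_zariski_eval_ne_zero hF0, ?_, fun c hc => ?_⟩
  · by_contra hne
    refine hF0 (MvPolynomial.funext fun c => ?_)
    by_contra h
    exact hne ⟨c, by simpa using h⟩
  have hbal := hF c hc
  obtain ⟨b, -, hab⟩ := hbal.exists_bezout hdk
  have hgcd := isMonicGcd_one_of_sum_mul_eq_one hab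
  refine ⟨le_antisymm (vecDegree_le_iff.2 fun i => natDegree_le_iff_degree_le.1
    (hbal.natDegree_le i)) ((le_degree_of_ne_zero hbal.coeff_ne_zero).trans
      (vecDegree_le_iff.1 le_rfl 0)), hgcd, fun P hP => le_antisymm ?_ ?_⟩
  · obtain ⟨P', hP', hord, hle⟩ := hbal.exists_movingFrame hdk
    exact matDegree_le_iff.2 fun j => (hP.2.2 P' hP' hord j).trans (hle j)
  · exact hP.1.le_matDegree hgcd hbal.coeff_ne_zero fun m => (hiff m).2
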